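/- Let $K$ be a field (of any characteristic) and let $n\ge 3$. Let $X=(x_{ij})$ and $Y=(y_{ij})$ be $n\times n$ matrices whose $2n^2$ entries are independent indeterminates, let $R=K[x_{ij},y_{ij} : 1\le i,j\le n]$, and let $C=XY-YX=(c_{ij})$. Let $\mathcal{I}\subset R$ be the ideal generated by all diagonal entries $c_{ii}$ and all anti-diagonal entries $c_{i,\,n+1-i}$, $1\le i\le n$. Then $\mathcal{I}$ is generated by a regular sequence in $R$, that is, $R/\mathcal{I}$ is a complete intersection. The Krull dimension of $R/\mathcal{I}$ is $2n^2-2n+2$ if $n$ is odd and $2n^2-2n+1$ if $n$ is even. -/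

import Mathlib

noncomputable section

namespace CommutatorMatrix

/-- The polynomial ring `R = K[X, Y]` in the `2 n ^ 2` entries of two generic `n × n` matrices:
the left summand indexes the `x_{ij}`, the right summand the `y_{ij}`. -/
abbrev PolyRing (K : Type*) [Field K] (n : ℕ) : Type _ :=
  MvPolynomial ((Fin n × Fin n) ⊕ (Fin n × Fin n)) K

/-- The generic matrix `X = (x_{ij})`. -/
def genericX (K : Type*) [Field K] (n : ℕ) : Matrix (Fin n) (Fin n) (PolyRing K n) :=
  Matrix.of fun i j => MvPolynomial.X (Sum.inl (i, j))

/-- The generic matrix `Y = (y_{ij})`. -/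
def genericY (K : Type*) [Field K] (n : ℕ) : Matrix (Fin n) (Fin n) (PolyRing K n) :=
  Matrix.of fun i j => MvPolynomial.X (Sum.inr (i, j))

/-- The commutator matrix `C = X Y - Y X`. -/
def commMatrix (K : Type*) [Field K] (n : ℕ) : Matrix (Fin n) (Fin n) (PolyRing K n) :=
  genericX K n * genericY K n - genericY K n * genericX K n

/-- The ideal generated by the diagonal entries of `C`. -/
def diagIdeal (K : Type*) [Field K] (n : ℕ) : Ideal (PolyRing K n) :=
  Ideal.span (Set.range fun i : Fin n => commMatrix K n i i)

/-- The ideal generated by the anti-diagonal entries of `C`. With indices starting at `0`,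
`Fin.rev i` is `n - 1 - i`. -/
def antidiagIdeal (K : Type*) [Field K] (n : ℕ) : Ideal (PolyRing K n) :=
  Ideal.span (Set.range fun i : Fin n => commMatrix K n i i.rev)

/-- The ideal generated by the diagonal and the anti-diagonal entries of `C`. -/
def diagAntidiagIdeal (K : Type*) [Field K] (n : ℕ) : Ideal (PolyRing K n) :=
  diagIdeal K n ⊔ antidiagIdeal K n

end CommutatorMatrix

end

universe u

namespace MonomialOrder

open MvPolynomial RingTheory.Sequence

/-- The monomial order that compares weights first and breaks ties lexicographically. -/
noncomputable def weightedLex {σ : Type*} [LinearOrder σ] [WellFoundedGT σ] (w : σ → ℕ) :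
    MonomialOrder σ :=
  let f : (σ →₀ ℕ) →+ Lex (ℕ × Lex (σ →₀ ℕ)) :=
    { toFun := fun a => toLex (Finsupp.weight w a, toLex a)
      map_zero' := by rw [map_zero]; rfl
      map_add' := fun a b => by rw [map_add]; rfl }
  have hf : Function.Injective f := fun a b h => by
    simpa [f] using congrArg (fun x => (ofLex x).2) h
  { syn := AddMonoidHom.mrange f
    addCommMonoidSyn := AddSubmonoid.toAddCommMonoid _
    toSyn :=
      { toEquiv := Equiv.ofBijective f.mrangeRestrict
          ⟨fun a b h => hf (congrArg Subtype.val h), f.mrangeRestrict_surjective⟩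
        map_add' := fun a b => Subtype.ext (f.map_add a b) }
    toSyn_monotone := fun a b h => by
      change f a ≤ f b
      refine Prod.Lex.toLex_mono ⟨?_, Finsupp.toLex_monotone h⟩
      obtain ⟨c, rfl⟩ := exists_add_of_le h
      simp }

theorem weightedLex_lt_of_weight_lt {σ : Type*} [LinearOrder σ] [WellFoundedGT σ] (w : σ → ℕ)
    {a b : σ →₀ ℕ} (h : Finsupp.weight w a < Finsupp.weight w b) :
    (weightedLex w).toSyn a < (weightedLex w).toSyn b :=
  Subtype.coe_lt_coe.1 (Prod.Lex.toLex_lt_toLex.2 (Or.inl h))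

theorem exists_toSyn_lt_of_weight_lt {σ : Type u} [Finite σ] (w : σ → ℕ) :
    ∃ m : MonomialOrder.{u, u} σ, ∀ a b, Finsupp.weight w a < Finsupp.weight w b →
      m.toSyn a < m.toSyn b := by
  let _ : LinearOrder σ := LinearOrder.lift' _ (Finite.equivFin σ).injective
  exact ⟨weightedLex w, fun _ _ => weightedLex_lt_of_weight_lt w⟩

variable {σ K : Type*} [Field K] (m : MonomialOrder σ)

theorem exists_sub_mem_span_of_forall_support (s : Set (MvPolynomial σ K)) (hs : ∀ f ∈ s, f ≠ 0)
    (h : MvPolynomial σ K) :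
    ∃ r, h - r ∈ Ideal.span s ∧ ∀ c ∈ r.support, ∀ f ∈ s, ¬ m.degree f ≤ c := by
  obtain ⟨g, r, h1, -, h3⟩ := m.div_set (B := s) (fun b hb => m.isUnit_leadingCoeff.2 (hs b hb)) h
  refine ⟨r, ?_, h3⟩
  rw [h1, add_sub_cancel_right, Finsupp.linearCombination_apply]
  exact Submodule.sum_mem _ fun i _ => Ideal.mul_mem_left _ _ (Ideal.subset_span i.2)

theorem le_of_le_add_of_disjoint_support {a b c : σ →₀ ℕ} (h : a ≤ b + c)
    (hd : Disjoint a.support c.support) : a ≤ b := by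
  intro x
  by_cases hx : a x = 0
  · simp [hx]
  · have := Finsupp.notMem_support_iff.1
      (Finset.disjoint_left.1 hd (Finsupp.mem_support_iff.2 hx))
    have h' := h x
    simpa [this] using h'

theorem exists_degree_le_of_mem_ofList (rs : List (MvPolynomial σ K)) (h0 : ∀ f ∈ rs, f ≠ 0)
    (hp : rs.Pairwise fun f g => Disjoint (m.degree f).support (m.degree g).support) :
    ∀ g ∈ Ideal.ofList rs, g ≠ 0 → ∃ f ∈ rs, m.degree f ≤ m.degree g := by
  induction rs using List.reverseRecOn with
  | nil => simp
  | append_singleton rs f ih =>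
    rw [List.pairwise_append] at hp
    have h0' : ∀ f ∈ rs, f ≠ 0 := fun f hf => h0 f (by simp [hf])
    have hf0 : f ≠ 0 := h0 f (by simp)
    intro g hg hg0
    rw [Ideal.ofList_append, Ideal.ofList_singleton, Submodule.mem_sup] at hg
    obtain ⟨a, ha, b, hb, rfl⟩ := hg
    obtain ⟨h, rfl⟩ := Ideal.mem_span_singleton'.1 hb
    obtain ⟨r, hr, hr'⟩ := m.exists_sub_mem_span_of_forall_support {f | f ∈ rs} h0' h
    obtain ⟨a', ha', he⟩ : ∃ a' ∈ Ideal.ofList rs, a + h * f = a' + r * f :=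
      ⟨a + (h - r) * f, add_mem ha (Ideal.mul_mem_right _ _ hr), by ring⟩
    rw [he] at hg0 ⊢
    by_cases hr0 : r = 0
    · simp only [hr0, zero_mul, add_zero] at hg0 ⊢
      obtain ⟨f', hf', hle⟩ := ih h0' hp.1 a' ha' hg0
      exact ⟨f', by simp [hf'], hle⟩
    have hd : m.degree (r * f) = m.degree r + m.degree f := m.degree_mul hr0 hf0
    by_cases ha0 : a' = 0
    · exact ⟨f, by simp, by simp [ha0, hd]⟩
    obtain ⟨f', hf', hle⟩ := ih h0' hp.1 a' ha' ha0
    rcases lt_trichotomy (m.toSyn (m.degree a')) (m.toSyn (m.degree (r * f))) with hlt | heq | hlt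
    · exact ⟨f, by simp, by rw [m.degree_add_eq_right_of_lt hlt, hd]; exact le_add_self⟩
    · rw [m.toSyn.injective heq, hd] at hle
      exact absurd (le_of_le_add_of_disjoint_support hle (hp.2.2 f' hf' f (by simp)))
        (hr' _ (m.degree_mem_support hr0) f' hf')
    · exact ⟨f', by simp [hf'], by rwa [m.degree_add_of_lt hlt]⟩

theorem isWeaklyRegular_of_pairwise_disjoint_degree (rs : List (MvPolynomial σ K))
    (h0 : ∀ f ∈ rs, f ≠ 0)
    (hp : rs.Pairwise fun f g => Disjoint (m.degree f).support (m.degree g).support) :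
    IsWeaklyRegular (MvPolynomial σ K) rs := by
  induction rs using List.reverseRecOn with
  | nil => exact .nil _ _
  | append_singleton rs f ih =>
    rw [List.pairwise_append] at hp
    have h0' : ∀ f ∈ rs, f ≠ 0 := fun f hf => h0 f (by simp [hf])
    have hf0 : f ≠ 0 := h0 f (by simp)
    rw [isWeaklyRegular_append_iff, isWeaklyRegular_singleton_iff]
    refine ⟨ih h0' hp.1, (isSMulRegular_iff_right_eq_zero_of_smul).2 fun x hx => ?_⟩
    obtain ⟨h, rfl⟩ := Submodule.Quotient.mk_surjective _ x
    rw [← Submodule.Quotient.mk_smul, Submodule.Quotient.mk_eq_zero] at hx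
    rw [Submodule.Quotient.mk_eq_zero]
    simp only [smul_eq_mul, Ideal.mul_top] at hx ⊢
    obtain ⟨r, hr, hr'⟩ := m.exists_sub_mem_span_of_forall_support {f | f ∈ rs} h0' h
    by_cases hr0 : r = 0
    · simpa [hr0] using hr
    have hmem : r * f ∈ Ideal.ofList rs := by
      have : r * f = f * h - (h - r) * f := by ring
      exact this ▸ sub_mem hx (Ideal.mul_mem_right _ _ hr)
    obtain ⟨f', hf', hle⟩ :=
      m.exists_degree_le_of_mem_ofList rs h0' hp.1 _ hmem (mul_ne_zero hr0 hf0)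
    rw [m.degree_mul hr0 hf0] at hle
    exact absurd (le_of_le_add_of_disjoint_support hle (hp.2.2 f' hf' f (by simp)))
      (hr' _ (m.degree_mem_support hr0) f' hf')

theorem isRegular_of_pairwise_disjoint_degree (rs : List (MvPolynomial σ K))
    (h0 : ∀ f ∈ rs, m.degree f ≠ 0)
    (hp : rs.Pairwise fun f g => Disjoint (m.degree f).support (m.degree g).support) :
    IsRegular (MvPolynomial σ K) rs := by
  have h0' : ∀ f ∈ rs, f ≠ 0 := fun f hf => m.ne_zero_of_degree_ne_zero (h0 f hf)
  refine ⟨m.isWeaklyRegular_of_pairwise_disjoint_degree rs h0' hp, fun h => ?_⟩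
  have h1 : (1 : MvPolynomial σ K) ∈ Ideal.ofList rs := by
    rw [← Ideal.eq_top_iff_one, h]
    simp
  obtain ⟨f, hf, hle⟩ := m.exists_degree_le_of_mem_ofList rs h0' hp 1 h1 one_ne_zero
  rw [m.degree_one] at hle
  exact h0 f hf (le_antisymm hle _root_.zero_le)

/-- Finitely many polynomials whose leading monomials are pairwise coprime form a regular
sequence. -/
theorem exists_isRegular_of_pairwise_disjoint_degree {ι : Type*} [Fintype ι]
    (f : ι → MvPolynomial σ K) (h0 : ∀ i, m.degree (f i) ≠ 0)
    (hp : Pairwise fun i j => Disjoint (m.degree (f i)).support (m.degree (f j)).support) :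
    ∃ rs : List (MvPolynomial σ K), IsRegular (MvPolynomial σ K) rs ∧
      Ideal.ofList rs = Ideal.span (Set.range f) ∧ rs.length = Fintype.card ι := by
  refine ⟨Finset.univ.toList.map f, m.isRegular_of_pairwise_disjoint_degree _ ?_ ?_, ?_, by simp⟩
  · simpa using h0
  · rw [List.pairwise_map]
    exact (Finset.nodup_toList _).imp fun h => hp h
  · exact congrArg Ideal.span (by ext; simp)

theorem degree_eq_of_sub_monomial {f : MvPolynomial σ K} {s : σ →₀ ℕ} {c : K} (hc : c ≠ 0)
    (h : ∀ t ∈ (f - monomial s c).support, m.toSyn t < m.toSyn s) : m.degree f = s := by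
  classical
  have hs : m.degree (monomial s c) = s := by rw [m.degree_monomial, if_neg hc]
  by_cases h0 : f - monomial s c = 0
  · rw [sub_eq_zero.1 h0, hs]
  · have := m.degree_add_of_lt (f := monomial s c) (g := f - monomial s c)
      (by rw [hs]; exact h _ (m.degree_mem_support h0))
    rwa [add_sub_cancel, hs] at this

end MonomialOrder

section Dimension

open RingTheory.Sequence

/-- Every maximal ideal of a polynomial ring over a field has full height. -/
theorem MvPolynomial.height_eq_card_of_isMaximal (K : Type*) [Field K] (σ : Type*) [Finite σ]
    (P : Ideal (MvPolynomial σ K)) [hP : P.IsMaximal] : P.height = Nat.card σ := by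
  induction σ using Finite.induction_empty_option with
  | of_equiv e H =>
    have := H (P.comap (renameEquiv K e).toRingEquiv)
    rwa [RingEquiv.height_comap, Nat.card_congr e] at this
  | h_empty =>
    have h := Ideal.height_le_ringKrullDim_of_ne_top hP.ne_top
    simpa using h
  | @h_option τ _ H =>
    let e := (optionEquivLeft K τ).toRingEquiv
    rw [← RingEquiv.height_map e P]
    have : (P.map e).IsMaximal := Ideal.map_isMaximal_of_equiv e
    set Q := P.map e
    have : (Q.comap Polynomial.C).IsMaximal := Polynomial.isMaximal_comap_C_of_isJacobsonRing Q
    have : Q.LiesOver (Q.comap Polynomial.C) := ⟨rfl⟩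
    rw [Polynomial.height_eq_height_add_one (Q.comap Polynomial.C) Q, H]
    simp

theorem Module.supportDim_add_length_le_of_isWeaklyRegular {R : Type*} [CommRing R]
    [IsNoetherianRing R] {M : Type*} [AddCommGroup M] [Module R M] [Module.Finite R M]
    (rs : List R) (reg : IsWeaklyRegular M rs) :
    supportDim R (M ⧸ Ideal.ofList rs • (⊤ : Submodule R M)) + rs.length ≤ supportDim R M := by
  induction rs generalizing M with
  | nil =>
    rw [Ideal.ofList_nil, Submodule.bot_smul]
    simpa using (supportDim_eq_of_equiv (Submodule.quotEquivOfEqBot ⊥ rfl)).le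
  | cons x rs' ih =>
    rw [isWeaklyRegular_cons_iff] at reg
    have h1 := supportDim_quotSMulTop_succ_le_of_notMem_minimalPrimes
      (fun _ => reg.1.notMem_of_mem_minimalPrimes)
    rw [supportDim_eq_of_equiv (Submodule.quotOfListConsSMulTopEquivQuotSMulTopInner M x _)]
    refine le_trans ?_ h1
    grw [← ih reg.2]
    simp [add_assoc]

theorem MvPolynomial.ringKrullDim_quotient_add_length_of_isRegular {K : Type*} [Field K]
    {σ : Type*} [Finite σ] (rs : List (MvPolynomial σ K))
    (reg : IsRegular (MvPolynomial σ K) rs) :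
    ringKrullDim (MvPolynomial σ K ⧸ Ideal.ofList rs) + rs.length = (Nat.card σ : ℕ) := by
  classical
  have htop : Ideal.ofList rs ≠ ⊤ := fun h => reg.top_ne_smul (by simp [h])
  apply le_antisymm
  · have h := Module.supportDim_add_length_le_of_isWeaklyRegular rs reg.toIsWeaklyRegular
    have eq : Ideal.ofList rs • (⊤ : Ideal (MvPolynomial σ K)) = Ideal.ofList rs := by simp
    rw [Module.supportDim_quotient_eq_ringKrullDim, Module.supportDim_self_eq_ringKrullDim,
      ringKrullDim_eq_of_ringEquiv (Ideal.quotientEquivAlgOfEq K eq).toRingEquiv] at h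
    simpa using h
  · obtain ⟨P, hP, hle⟩ := Ideal.exists_le_maximal _ htop
    have h := Ideal.height_le_ringKrullDim_quotient_add_encard (p := P) {r | r ∈ rs}
      (Ideal.span_le.1 hle)
    rw [MvPolynomial.height_eq_card_of_isMaximal] at h
    refine le_trans (by simpa using h) ?_
    gcongr
    have : {r | r ∈ rs} = (rs.toFinset : Set (MvPolynomial σ K)) := by ext; simp
    rw [this, Set.encard_coe_eq_coe_finsetCard]
    exact_mod_cast List.toFinset_card_le rs

end Dimension

namespace MonomialOrder

open MvPolynomial

variable {σ K : Type*} [Field K] (m : MonomialOrder σ)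

theorem degree_sum_sub_eq {κ : Type*} [Fintype κ] (u u' : κ → σ →₀ ℕ) (k₀ : κ)
    (h0 : m.toSyn (u' k₀) < m.toSyn (u k₀))
    (h : ∀ k, k ≠ k₀ → u k = u' k ∨
      m.toSyn (u k) < m.toSyn (u k₀) ∧ m.toSyn (u' k) < m.toSyn (u k₀)) :
    m.degree (∑ k, (monomial (u k) (1 : K) - monomial (u' k) 1)) = u k₀ := by
  classical
  refine m.degree_eq_of_sub_monomial one_ne_zero fun t ht => ?_
  let W := restrictSupport K {t : σ →₀ ℕ | m.toSyn t < m.toSyn (u k₀)}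
  suffices hW : ∑ k, (monomial (u k) (1 : K) - monomial (u' k) 1) - monomial (u k₀) 1 ∈ W from
    (mem_restrictSupport_iff K).1 hW ht
  rw [← Finset.add_sum_erase _ _ (Finset.mem_univ k₀), add_sub_right_comm, sub_sub_cancel_left]
  refine add_mem (neg_mem ((monomial_mem_restrictSupport K).2 (Or.inl h0)))
    (Submodule.sum_mem _ fun k hk => ?_)
  rcases h k (Finset.ne_of_mem_erase hk) with he | ⟨h1, h2⟩
  · rw [he, sub_self]
    exact zero_mem _
  · exact sub_mem ((monomial_mem_restrictSupport K).2 (Or.inl h1))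
      ((monomial_mem_restrictSupport K).2 (Or.inl h2))

end MonomialOrder

namespace CommutatorMatrix

open MvPolynomial

section Weights

variable {n : ℕ}

/-- Weights `v a b` of `x_{ab}` and of `y_{ba}`. -/
def entryWeight (v : Fin n → Fin n → ℕ) : (Fin n × Fin n) ⊕ (Fin n × Fin n) → ℕ :=
  Sum.elim (fun a => v a.1 a.2) (fun a => v a.2 a.1)

/-- The exponent of `x_a * y_b`. -/
noncomputable def pairExponent (a b : Fin n × Fin n) : (Fin n × Fin n) ⊕ (Fin n × Fin n) →₀ ℕ :=
  Finsupp.single (Sum.inl a) 1 + Finsupp.single (Sum.inr b) 1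

theorem weight_pairExponent (v : Fin n → Fin n → ℕ) (a b : Fin n × Fin n) :
    Finsupp.weight (entryWeight v) (pairExponent a b) = v a.1 a.2 + v b.2 b.1 := by
  simp [pairExponent, entryWeight, Finsupp.weight_single]

theorem pairExponent_ne_zero (a b : Fin n × Fin n) : pairExponent a b ≠ 0 := by
  intro h
  simpa [pairExponent] using DFunLike.congr_fun h (Sum.inl a)

theorem disjoint_support_pairExponent {a b a' b' : Fin n × Fin n} (ha : a ≠ a') (hb : b ≠ b') :
    Disjoint (pairExponent a b).support (pairExponent a' b').support := by
  classical
  rw [Finset.disjoint_left]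
  intro t ht ht'
  rw [Finsupp.mem_support_iff] at ht ht'
  rcases t with t | t
  · simp [pairExponent, Finsupp.single_apply] at ht ht'
    exact ha (ht.trans ht'.symm)
  · simp [pairExponent, Finsupp.single_apply] at ht ht'
    exact hb (ht.trans ht'.symm)

variable (K : Type*) [Field K]

theorem commMatrix_apply (a b : Fin n) :
    commMatrix K n a b = ∑ k, (monomial (pairExponent (a, k) (k, b)) (1 : K) -
      monomial (pairExponent (k, b) (a, k)) 1) := by
  simp only [commMatrix, Matrix.sub_apply, Matrix.mul_apply, ← Finset.sum_sub_distrib, genericX,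
    genericY, Matrix.of_apply]
  refine Finset.sum_congr rfl fun k _ => ?_
  congr 1
  · rw [X, X, monomial_mul, one_mul, pairExponent]
  · rw [X, X, monomial_mul, one_mul, pairExponent, add_comm]

variable {K} (m : MonomialOrder ((Fin n × Fin n) ⊕ (Fin n × Fin n))) {v : Fin n → Fin n → ℕ}
  (hm : ∀ s t, Finsupp.weight (entryWeight v) s < Finsupp.weight (entryWeight v) t →
    m.toSyn s < m.toSyn t)
include hm

theorem degree_commMatrix_eq_left {a b : Fin n} (k₀ : Fin n) (N : ℕ)
    (hN : v a k₀ + v b k₀ = N) (h0 : v k₀ a + v k₀ b < N)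
    (h : ∀ k, k ≠ k₀ → (a = b ∧ k = a) ∨ (v a k + v b k < N ∧ v k a + v k b < N)) :
    m.degree (commMatrix K n a b) = pairExponent (a, k₀) (k₀, b) := by
  rw [commMatrix_apply]
  refine m.degree_sum_sub_eq (fun k => pairExponent (a, k) (k, b))
    (fun k => pairExponent (k, b) (a, k)) k₀ ?_ fun k hk => (h k hk).imp ?_ (And.imp ?_ ?_)
  · apply hm; simp only [weight_pairExponent]; omega
  · rintro ⟨rfl, rfl⟩; rfl
  · intro h; apply hm; simp only [weight_pairExponent]; omega
  · intro h; apply hm; simp only [weight_pairExponent]; omega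

theorem degree_commMatrix_eq_right {a b : Fin n} (k₀ : Fin n) (N : ℕ)
    (hN : v k₀ a + v k₀ b = N) (h0 : v a k₀ + v b k₀ < N)
    (h : ∀ k, k ≠ k₀ → (a = b ∧ k = a) ∨ (v a k + v b k < N ∧ v k a + v k b < N)) :
    m.degree (commMatrix K n a b) = pairExponent (k₀, b) (a, k₀) := by
  rw [commMatrix_apply, ← m.degree_neg, ← Finset.sum_neg_distrib]
  simp only [neg_sub]
  refine m.degree_sum_sub_eq (fun k => pairExponent (k, b) (a, k))
    (fun k => pairExponent (a, k) (k, b)) k₀ ?_ fun k hk => (h k hk).imp ?_ fun h => ⟨?_, ?_⟩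
  · apply hm; simp only [weight_pairExponent]; omega
  · rintro ⟨rfl, rfl⟩; rfl
  · apply hm; simp only [weight_pairExponent]; omega
  · apply hm; simp only [weight_pairExponent]; omega

end Weights

/-- Weights on ordered pairs of indices, for a base index `p` that is central when `n` is odd and
`0` when `n` is even. -/
def pivotWeight (n p a b : ℕ) : ℕ :=
  if b = p ∧ 2 * a + 1 < n ∧ a ≠ p then 4
  else if a = p ∧ n < 2 * b + 1 ∧ b + p + 1 ≠ n then 4
  else if 2 * a + 1 < n ∧ a + b + 1 = n then 2
  else if a = b ∧ n < 2 * a + 1 then 4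
  else if a + p + 1 = n ∧ a ≠ p ∧ b = 1 then 3
  else 0

/-- The admissible base indices. -/
def IsPivot (n p : ℕ) : Prop := 2 * p + 1 = n ∨ p = 0 ∧ n % 2 = 0 ∧ 4 ≤ n

namespace IsPivot

variable {n p i j : ℕ} (hp : IsPivot n p)
include hp

theorem pivotWeight_diag_lower (hi : 2 * i + 1 < n) (hip : i ≠ p) :
    pivotWeight n p i p = 4 ∧ pivotWeight n p p i < 4 ∧
      ∀ k, k ≠ p → k ≠ i → pivotWeight n p i k < 4 ∧ pivotWeight n p k i < 4 := by
  unfold IsPivot at hp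
  refine ⟨?_, ?_, fun k h1 h2 => ⟨?_, ?_⟩⟩ <;> grind [pivotWeight]

theorem pivotWeight_diag_upper (hi : n < 2 * i + 1) (hin : i < n) (hip : i + p + 1 ≠ n) :
    pivotWeight n p p i = 4 ∧ pivotWeight n p i p < 4 ∧
      ∀ k < n, k ≠ p → k ≠ i → pivotWeight n p i k < 4 ∧ pivotWeight n p k i < 4 := by
  unfold IsPivot at hp
  refine ⟨?_, ?_, fun k h1 h2 h3 => ⟨?_, ?_⟩⟩ <;> grind [pivotWeight]

theorem pivotWeight_diag_rev (hi : i + p + 1 = n) (hip : i ≠ p) :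
    pivotWeight n p i 1 = 3 ∧ pivotWeight n p 1 i < 3 ∧
      ∀ k < n, k ≠ 1 → k ≠ i → pivotWeight n p i k < 3 ∧ pivotWeight n p k i < 3 := by
  unfold IsPivot at hp
  refine ⟨?_, ?_, fun k h1 h2 h3 => ⟨?_, ?_⟩⟩ <;> grind [pivotWeight]

theorem pivotWeight_antidiag (hi : 2 * i + 1 < n) (hij : i + j + 1 = n) :
    pivotWeight n p i j + pivotWeight n p j j = 6 ∧ pivotWeight n p j i + pivotWeight n p j j < 6 ∧
      ∀ k < n, k ≠ j → pivotWeight n p i k + pivotWeight n p j k < 6 ∧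
        pivotWeight n p k i + pivotWeight n p k j < 6 := by
  unfold IsPivot at hp
  refine ⟨?_, ?_, fun k h1 h2 => ⟨?_, ?_⟩⟩ <;> grind (splits := 20) [pivotWeight]

end IsPivot

section Leading

variable {n : ℕ} (K : Type*) [Field K] {p e : Fin n}

/-- The leading `x`-variable of a diagonal entry; the leading `y`-variable is its transpose. -/
def diagLead (p e i : Fin n) : Fin n × Fin n :=
  if 2 * i.val + 1 < n then (i, p) else if i.val + p.val + 1 ≠ n then (p, i) else (i, e)

/-- The leading `x`-variable of an anti-diagonal entry. -/
def antidiagLeadX (i : Fin n) : Fin n × Fin n :=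
  if 2 * i.val + 1 < n then (i, i.rev) else (i, i)

/-- The leading `y`-variable of an anti-diagonal entry. -/
def antidiagLeadY (i : Fin n) : Fin n × Fin n :=
  if 2 * i.val + 1 < n then (i.rev, i.rev) else (i, i.rev)

variable (m : MonomialOrder ((Fin n × Fin n) ⊕ (Fin n × Fin n)))
  (hm : ∀ s t, Finsupp.weight (entryWeight fun a b : Fin n => pivotWeight n p a b) s <
    Finsupp.weight (entryWeight fun a b : Fin n => pivotWeight n p a b) t →
    m.toSyn s < m.toSyn t)
  (hp : IsPivot n p)
include hm hp

theorem degree_commMatrix_diag (he : e.val = 1) (i : Fin n) (hi : i ≠ p) :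
    m.degree (commMatrix K n i i) = pairExponent (diagLead p e i) (diagLead p e i).swap := by
  have hi' : i.val ≠ p.val := fun h => hi (Fin.ext h)
  have hmid : 2 * i.val + 1 ≠ n := by unfold IsPivot at hp; omega
  unfold diagLead
  split_ifs with h1 h2
  · obtain ⟨ha, hb, hc⟩ := hp.pivotWeight_diag_lower h1 hi'
    refine degree_commMatrix_eq_left m hm p 8 (by omega) (by omega) fun k hk => ?_
    refine or_iff_not_imp_left.2 fun hki => ?_
    have := hc k (fun h => hk (Fin.ext h)) fun h => hki ⟨rfl, Fin.ext h⟩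
    omega
  · obtain ⟨ha, hb, hc⟩ := hp.pivotWeight_diag_upper (by omega) i.isLt h2
    refine degree_commMatrix_eq_right m hm p 8 (by omega) (by omega) fun k hk => ?_
    refine or_iff_not_imp_left.2 fun hki => ?_
    have := hc k k.isLt (fun h => hk (Fin.ext h)) fun h => hki ⟨rfl, Fin.ext h⟩
    omega
  · obtain ⟨ha, hb, hc⟩ := hp.pivotWeight_diag_rev (not_not.1 h2) hi'
    rw [← he] at ha hb hc
    refine degree_commMatrix_eq_left m hm e 6 (by omega) (by omega) fun k hk => ?_
    refine or_iff_not_imp_left.2 fun hki => ?_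
    have := hc k k.isLt (fun h => hk (Fin.ext h)) fun h => hki ⟨rfl, Fin.ext h⟩
    omega

theorem degree_commMatrix_antidiag (i : Fin n) (hi : i ≠ i.rev) :
    m.degree (commMatrix K n i i.rev) = pairExponent (antidiagLeadX i) (antidiagLeadY i) := by
  have hi' : i.val ≠ i.rev.val := fun h => hi (Fin.ext h)
  have hr : i.val + i.rev.val + 1 = n := by rw [Fin.val_rev]; omega
  unfold antidiagLeadX antidiagLeadY
  split_ifs with h1
  · obtain ⟨ha, hb, hc⟩ := hp.pivotWeight_antidiag h1 hr
    exact degree_commMatrix_eq_left m hm i.rev 6 ha hb fun k hk =>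
      Or.inr (hc k k.isLt fun h => hk (Fin.ext h))
  · obtain ⟨ha, hb, hc⟩ := hp.pivotWeight_antidiag (i := i.rev) (j := i) (by omega) (by omega)
    refine degree_commMatrix_eq_left m hm i 6 (by omega) (by omega) fun k hk => Or.inr ?_
    have := hc k k.isLt fun h => hk (Fin.ext h)
    omega

omit hm in
theorem diagLead_ne_antidiagLead (he : e.val = 1) (i j : Fin n) (hi : i ≠ p) (hj : j ≠ j.rev) :
    diagLead p e i ≠ antidiagLeadX j ∧ (diagLead p e i).swap ≠ antidiagLeadY j := by
  have := i.isLt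
  have := j.isLt
  unfold diagLead antidiagLeadX antidiagLeadY IsPivot at *
  simp only [ne_eq, Fin.ext_iff, Fin.val_rev] at hi hj
  split_ifs <;> simp only [Prod.swap_prod_mk, ne_eq, Prod.mk.injEq, Fin.ext_iff, Fin.val_rev] <;>
    grind

omit hm hp in
theorem diagLead_injOn : Set.InjOn (diagLead p e) {i | i ≠ p} := by
  intro i hi j hj h
  simp only [Set.mem_ofPred_eq] at hi hj
  unfold diagLead at h
  split_ifs at h <;> simp only [Prod.mk.injEq, Fin.ext_iff, ne_eq] at * <;> omega

omit hm hp in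
theorem antidiagLeadX_injective : Function.Injective (antidiagLeadX (n := n)) := by
  intro i j h
  unfold antidiagLeadX at h
  split_ifs at h <;> simp only [Prod.mk.injEq, Fin.ext_iff, Fin.val_rev] at * <;> omega

omit hm hp in
theorem antidiagLeadY_injective : Function.Injective (antidiagLeadY (n := n)) := by
  intro i j h
  unfold antidiagLeadY at h
  split_ifs at h <;> simp only [Prod.mk.injEq, Fin.ext_iff, Fin.val_rev] at * <;> omega

end Leading

section Generators

variable (K : Type*) [Field K] {n : ℕ}

/-- The generators of the ideal: the diagonal entries other than the one at `p`, and the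
anti-diagonal entries off the diagonal. -/
noncomputable def commGenerator (p : Fin n) : {i : Fin n // i ≠ p} ⊕ {i : Fin n // i ≠ i.rev} → PolyRing K n :=
  Sum.elim (fun i => commMatrix K n i i) fun i => commMatrix K n i i.1.rev

theorem span_commGenerator (p : Fin n) :
    Ideal.span (Set.range (commGenerator K p)) = diagAntidiagIdeal K n := by
  have htr : commMatrix K n p p = -∑ i ∈ Finset.univ.erase p, commMatrix K n i i := by
    rw [eq_neg_iff_add_eq_zero, Finset.add_sum_erase _ (fun i => commMatrix K n i i)
      (Finset.mem_univ p)]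
    change (commMatrix K n).trace = 0
    rw [commMatrix, Matrix.trace_sub, Matrix.trace_mul_comm, sub_self]
  have hdiag : ∀ i, commMatrix K n i i ∈ Ideal.span (Set.range (commGenerator K p)) := by
    have hne : ∀ i, i ≠ p → commMatrix K n i i ∈ Ideal.span (Set.range (commGenerator K p)) :=
      fun i hi => Ideal.subset_span ⟨Sum.inl ⟨i, hi⟩, rfl⟩
    intro i
    by_cases hi : i = p
    · rw [hi, htr]
      exact neg_mem (Submodule.sum_mem _ fun j hj => hne j (Finset.ne_of_mem_erase hj))
    · exact hne i hi
  apply le_antisymm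
  · rw [Ideal.span_le, Set.range_subset_iff]
    rintro (i | i)
    · exact Ideal.mem_sup_left (Ideal.subset_span ⟨i.1, rfl⟩)
    · exact Ideal.mem_sup_right (Ideal.subset_span ⟨i.1, rfl⟩)
  · refine sup_le (Ideal.span_le.2 (Set.range_subset_iff.2 fun i => ?_))
      (Ideal.span_le.2 (Set.range_subset_iff.2 fun i => ?_))
    · exact hdiag i
    · by_cases hi : i = i.rev
      · rw [SetLike.mem_coe, ← hi]
        exact hdiag i
      · exact Ideal.subset_span ⟨Sum.inr ⟨i, hi⟩, rfl⟩

theorem exists_isRegular_ofList_eq (p : Fin n) (hp : IsPivot n p) (hn : 1 < n) :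
    ∃ rs : List (PolyRing K n), RingTheory.Sequence.IsRegular (PolyRing K n) rs ∧
      Ideal.ofList rs = diagAntidiagIdeal K n ∧
      rs.length = n - 1 + Fintype.card {i : Fin n // i ≠ i.rev} := by
  let w := entryWeight fun a b : Fin n => pivotWeight n p a b
  obtain ⟨m, hm⟩ := MonomialOrder.exists_toSyn_lt_of_weight_lt w
  let e : Fin n := ⟨1, hn⟩
  let u : {i : Fin n // i ≠ p} ⊕ {i : Fin n // i ≠ i.rev} → Fin n × Fin n :=
    Sum.elim (fun i => diagLead p e i) fun i => antidiagLeadX i.1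
  let u' : {i : Fin n // i ≠ p} ⊕ {i : Fin n // i ≠ i.rev} → Fin n × Fin n :=
    Sum.elim (fun i => (diagLead p e i).swap) fun i => antidiagLeadY i.1
  have hdeg : ∀ i, m.degree (commGenerator K p i) = pairExponent (u i) (u' i) := by
    rintro (i | i)
    · exact degree_commMatrix_diag K m hm hp rfl i.1 i.2
    · exact degree_commMatrix_antidiag K m hm hp i.1 i.2
  have hu : Function.Injective u :=
    (Set.injOn_iff_injective.1 diagLead_injOn).sumElim
      (antidiagLeadX_injective.comp Subtype.val_injective)
      fun i j => (diagLead_ne_antidiagLead (e := e) hp rfl i.1 j.1 i.2 j.2).1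
  have hu' : Function.Injective u' :=
    (Prod.swap_injective.comp (Set.injOn_iff_injective.1 diagLead_injOn)).sumElim
      (antidiagLeadY_injective.comp Subtype.val_injective)
      fun i j => (diagLead_ne_antidiagLead (e := e) hp rfl i.1 j.1 i.2 j.2).2
  obtain ⟨rs, h1, h2, h3⟩ := m.exists_isRegular_of_pairwise_disjoint_degree (commGenerator K p)
    (fun i => by rw [hdeg]; exact pairExponent_ne_zero _ _)
    (fun i j hij => by
      simp only [hdeg]
      exact disjoint_support_pairExponent (hu.ne hij) (hu'.ne hij))
  refine ⟨rs, h1, h2.trans (span_commGenerator K p), ?_⟩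
  rw [h3, Fintype.card_sum, Fintype.card_subtype_compl, Fintype.card_fin,
    Fintype.card_subtype_eq]

theorem card_ne_rev_of_odd (hn : Odd n) : Fintype.card {i : Fin n // i ≠ i.rev} = n - 1 := by
  obtain ⟨k, hk⟩ := hn
  have h : ∀ i : Fin n, i ≠ i.rev ↔ i ≠ ⟨k, by omega⟩ := fun i => by
    simp only [ne_eq, Fin.ext_iff, Fin.val_rev]
    omega
  rw [Fintype.card_congr (Equiv.subtypeEquivRight h), Fintype.card_subtype_compl,
    Fintype.card_fin, Fintype.card_subtype_eq]

theorem card_ne_rev_of_even (hn : Even n) : Fintype.card {i : Fin n // i ≠ i.rev} = n := by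
  obtain ⟨k, hk⟩ := hn
  have h : ∀ i : Fin n, i ≠ i.rev := fun i => by
    simp only [ne_eq, Fin.ext_iff, Fin.val_rev]
    omega
  rw [Fintype.card_congr (Equiv.subtypeUnivEquiv h), Fintype.card_fin]

theorem ringKrullDim_eq_of_isRegular {rs : List (PolyRing K n)}
    (h : RingTheory.Sequence.IsRegular (PolyRing K n) rs)
    (hI : Ideal.ofList rs = diagAntidiagIdeal K n) {d : ℕ} (hd : d + rs.length = 2 * n ^ 2) :
    ringKrullDim (PolyRing K n ⧸ diagAntidiagIdeal K n) = (d : WithBot ℕ∞) := by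
  have h1 := MvPolynomial.ringKrullDim_quotient_add_length_of_isRegular rs h
  have h2 : Nat.card ((Fin n × Fin n) ⊕ (Fin n × Fin n)) = d + rs.length := by
    rw [hd]
    simp
    ring
  rw [hI, h2, Nat.cast_add] at h1
  exact ENat.WithBot.add_natCast_cancel.1 h1

end Generators

end CommutatorMatrix

theorem mainTheorem4 (K : Type*) [Field K] (n : ℕ) (hn : 3 ≤ n) :
    (∃ rs : List (CommutatorMatrix.PolyRing K n),
      RingTheory.Sequence.IsRegular (CommutatorMatrix.PolyRing K n) rs ∧
        Ideal.ofList rs = CommutatorMatrix.diagAntidiagIdeal K n) ∧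
    (Odd n →
      ringKrullDim (CommutatorMatrix.PolyRing K n ⧸ CommutatorMatrix.diagAntidiagIdeal K n) =
        ((2 * n ^ 2 - 2 * n + 2 : ℕ) : WithBot ℕ∞)) ∧
    (Even n →
      ringKrullDim (CommutatorMatrix.PolyRing K n ⧸ CommutatorMatrix.diagAntidiagIdeal K n) =
        ((2 * n ^ 2 - 2 * n + 1 : ℕ) : WithBot ℕ∞)) := by
  obtain ⟨p, hp⟩ : ∃ p : Fin n, CommutatorMatrix.IsPivot n p := by
    rcases Nat.even_or_odd' n with ⟨k, hk | hk⟩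
    · exact ⟨⟨0, by omega⟩, Or.inr ⟨rfl, by omega, by omega⟩⟩
    · exact ⟨⟨k, by omega⟩, Or.inl hk.symm⟩
  obtain ⟨rs, h1, h2, h3⟩ := CommutatorMatrix.exists_isRegular_ofList_eq K p hp (by omega)
  have hsq : n ≤ n ^ 2 := Nat.le_self_pow two_ne_zero n
  refine ⟨⟨rs, h1, h2⟩, fun ho => ?_, fun he => ?_⟩
  · rw [CommutatorMatrix.card_ne_rev_of_odd ho] at h3
    exact CommutatorMatrix.ringKrullDim_eq_of_isRegular K h1 h2 (by omega)
  · rw [CommutatorMatrix.card_ne_rev_of_even he] at h3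
    exact CommutatorMatrix.ringKrullDim_eq_of_isRegular K h1 h2 (by omega)
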